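/- For a polynomial $P\in\mathbb{C}[z]$ let $E_P(0)=\{z\in\mathbb{C} : \ln|P(z)|=0\}=\{z\in\mathbb{C} : |P(z)|=1\}$, and let $|E_P(0)|$ denote the length (one-dimensional Hausdorff measure) of this set. Let $P$ be a monic polynomial of degree $n\ge 1$ such that the lemniscate $E_P(0)$ is connected. Then $$|E_P(0)|\ge 2\pi,$$ and equality holds if and only if $P(z)=(z-a)^n$ for some $a\in\mathbb{C}$. -/

import Mathlib

open MeasureTheory

/-- The level set `ln |f(z)| = t` of a complex function `f`. Zeros of `f` are excluded explicitly,
since there `ln |f(z)|` is `-∞`, whereas `Real.log 0 = 0`. -/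
def levelSet (f : ℂ → ℂ) (t : ℝ) : Set ℂ :=
  {z | f z ≠ 0 ∧ Real.log ‖f z‖ = t}

/-- The lemniscate `E_P(t)` of a polynomial. -/
def lemniscate (P : Polynomial ℂ) (t : ℝ) : Set ℂ :=
  levelSet (fun z => P.eval z) t

/-- The length of a plane set: one-dimensional Hausdorff measure for the Euclidean metric
(normalized so that segments have their usual length), with values in `[0, ∞]`. -/
noncomputable def planeLength (E : Set ℂ) : ENNReal :=
  Measure.hausdorffMeasure 1 E

/-- A `K`-polynomial: the lemniscate `|P(z)| = 1` is connected. -/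
def IsKPolynomial (P : Polynomial ℂ) : Prop :=
  IsConnected (lemniscate P 0)

theorem mem_lemniscate_zero_iff (P : Polynomial ℂ) (z : ℂ) :
    z ∈ lemniscate P 0 ↔ ‖P.eval z‖ = 1 := by
  constructor
  · rintro ⟨h0, h⟩
    exact Real.eq_one_of_pos_of_log_eq_zero (norm_pos_iff.mpr h0) h
  · intro h
    refine ⟨?_, ?_⟩
    · intro h0
      simp only [h0, norm_zero] at h
      exact zero_ne_one h
    · change Real.log ‖P.eval z‖ = 0
      rw [h, Real.log_one]

/-! Connectedness of the lemniscate makes all zeros of `P` lie in one connected part of `|P| < r`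
for every `r > 1`, so `P` has a holomorphic `n`-th root `Φ(z) ~ z` on `|P| > r`. Its inverses glue
to an injective map `Ψ` on `|w| > 1` with `P(Ψ(w)) = w ^ n` and `Ψ(w) = w + b₀ + b₁ / w + ⋯`. Since
`P ∘ Ψ` extends to the unit circle, so does `Ψ`, and `γ(t) = Ψ(exp(it))` is a closed curve in the
lemniscate that repeats values only at critical points of `P`
(`IsKPolynomial.exists_boundary_curve`).

Formally, the length is at least `|∫ exp(-it) dγ| = 2π`, because the coefficient of `w` in `Ψ` is
`1`. As `γ` need not be differentiable, `norm_sum_fourier_le` proves such bounds by difference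
quotients, for any trigonometric polynomial in place of `exp(-it)`.

If the length is `2π`, the test function is varied. A perturbation of `exp(-it)` of size `ε`,
orthogonal to it in phase, raises the sup norm only by `O(ε ^ 2)` (`norm_perturbed_exp_le`) but the
pairing by `ε k |c|`, where `c` is the Fourier coefficient of `γ` at `-k`. Hence `c = 0` for all `k
> 0`, `γ(t) = b + exp(it)`, and `P = (z - b) ^ n` on a circle, hence everywhere. -/

open Filter Topology Polynomial

/-! ### Length and Fourier coefficients of a closed curve -/

/-- A preconnected plane set is at least as long as the distance between any two of its points. -/
theorem edist_le_hausdorffMeasure_of_isPreconnected {A : Set ℂ} (hA : IsPreconnected A)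
    {x y : ℂ} (hx : x ∈ A) (hy : y ∈ A) : edist x y ≤ Measure.hausdorffMeasure 1 A := by
  -- The distance from `x` does not increase length and maps `A` onto a set containing `[0, dist x
  -- y]`.
  have hlip : LipschitzWith 1 (fun z : ℂ => dist x z) := LipschitzWith.dist_right x
  have h1 := (hlip.lipschitzOnWith (s := A)).hausdorffMeasure_image_le (d := 1) zero_le_one
  have h2 : Set.Icc (dist x x) (dist x y) ⊆ (fun z : ℂ => dist x z) '' A :=
    hA.intermediate_value hx hy hlip.continuous.continuousOn
  have h3 := measure_mono (μ := (Measure.hausdorffMeasure 1 : Measure ℝ)) h2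
  rw [hausdorffMeasure_real, Real.volume_Icc, dist_self, sub_zero, ← edist_dist] at h3
  calc edist x y ≤ _ := h3
    _ ≤ _ := by simpa [hausdorffMeasure_real] using h1

/-- Each side of an inscribed polygon is at most the measure of its arc, and the arcs overlap only
in null sets, so their measures add up inside `E`. -/
theorem sum_edist_le_hausdorffMeasure {γ : ℝ → ℂ} (hγ : Continuous γ) {C E : Set ℂ}
    (hC : C.Countable) (hE : ∀ t, γ t ∈ E)
    (hinj : ∀ s t, s < t → t < s + 2 * Real.pi → γ s = γ t → γ s ∈ C) (θ : ℝ) {N : ℕ}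
    (hN : 0 < N) :
    ∑ k ∈ Finset.range N, edist (γ (θ + k * (2 * Real.pi / N)))
      (γ (θ + (k + 1 : ℕ) * (2 * Real.pi / N))) ≤ Measure.hausdorffMeasure 1 E := by
  set h : ℝ := 2 * Real.pi / N with hh
  have hN' : (0 : ℝ) < N := by exact_mod_cast hN
  have hpos : 0 < h := by positivity
  have hNh : N * h = 2 * Real.pi := by rw [hh]; field_simp
  set A : ℕ → Set ℂ := fun k => γ '' Set.Icc (θ + k * h) (θ + (k + 1 : ℕ) * h) with hA
  have hle : ∀ k : ℕ, θ + k * h ≤ θ + (k + 1 : ℕ) * h := by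
    intro k; push_cast; nlinarith
  have hdisj : ∀ k l : ℕ, k < l → l < N →
      AEDisjoint (Measure.hausdorffMeasure 1 : Measure ℂ) (A k) (A l) := by
    intro k l hkl hl
    -- Besides `C`, two arcs can share the point where consecutive arcs join, or `γ θ`, where the
    -- last arc closes up with the first.
    have hsub : A k ∩ A l ⊆ C ∪ {γ θ, γ (θ + (k + 1 : ℕ) * h)} := by
      rintro z ⟨⟨s, ⟨hs1, hs2⟩, rfl⟩, ⟨t, ⟨ht1, ht2⟩, hts⟩⟩
      have h1 : ((k + 1 : ℕ) : ℝ) * h ≤ l * h := by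
        gcongr; exact_mod_cast hkl
      have h2 : ((l + 1 : ℕ) : ℝ) * h ≤ N * h := by
        gcongr; exact_mod_cast hl
      have h0 : 0 ≤ (k : ℝ) * h := by positivity
      rcases eq_or_lt_of_le (show s ≤ t by linarith) with rfl | hst
      · right; right
        have : s = θ + (k + 1 : ℕ) * h := by linarith
        rw [this]; rfl
      · rcases eq_or_lt_of_le (show t ≤ s + 2 * Real.pi by linarith) with he | hlt
        · right; left
          have : s = θ := by linarith
          rw [this]
        · left; exact hinj s t hst hlt hts.symm
    exact measure_mono_null hsub (haveI := Measure.nullSingletonClass_hausdorff ℂ (one_pos (α := ℝ)); (hC.union (by simp)).measure_zero _)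
  have hsum : ∑ k ∈ Finset.range N, Measure.hausdorffMeasure 1 (A k) =
      Measure.hausdorffMeasure 1 (⋃ k ∈ Finset.range N, A k) := by
    refine (measure_biUnion_finset₀ ?_ ?_).symm
    · intro k hk l hl hne
      simp only [Finset.coe_range, Set.mem_Iio] at hk hl
      rcases lt_or_gt_of_ne hne with h | h
      · exact hdisj k l h hl
      · exact (hdisj l k h hk).symm
    · intro k _
      exact (isCompact_Icc.image hγ).measurableSet.nullMeasurableSet
  calc _ ≤ ∑ k ∈ Finset.range N, Measure.hausdorffMeasure 1 (A k) := by
        refine Finset.sum_le_sum fun k _ => ?_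
        refine edist_le_hausdorffMeasure_of_isPreconnected
          (isPreconnected_Icc.image γ hγ.continuousOn) ?_ ?_
        · exact ⟨_, Set.left_mem_Icc.2 (hle k), rfl⟩
        · exact ⟨_, Set.right_mem_Icc.2 (hle k), rfl⟩
    _ ≤ _ := by
        rw [hsum]
        refine measure_mono ?_
        simp only [Set.iUnion_subset_iff]
        rintro k - _ ⟨t, -, rfl⟩
        exact hE t

/-- Folding the period onto `[0, 2π / N]` turns the integrand into the perimeter of the inscribed
`N`-gon starting at `γ t`, which is at most the length for every `t`. -/
theorem integral_norm_translate_sub_le {γ : ℝ → ℂ} (hγ : Continuous γ) {C E : Set ℂ}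
    (hC : C.Countable) (hE : ∀ t, γ t ∈ E)
    (hinj : ∀ s t, s < t → t < s + 2 * Real.pi → γ s = γ t → γ s ∈ C)
    (hfin : Measure.hausdorffMeasure 1 E ≠ ⊤) {N : ℕ} (hN : 0 < N) :
    ∫ t in (0 : ℝ)..(2 * Real.pi), ‖γ (t + 2 * Real.pi / N) - γ t‖ ≤
      2 * Real.pi / N * (Measure.hausdorffMeasure 1 E).toReal := by
  set h : ℝ := 2 * Real.pi / N with hh
  have hN' : (0 : ℝ) < N := by exact_mod_cast hN
  have hpos : 0 < h := by positivity
  have hNh : N * h = 2 * Real.pi := by rw [hh]; field_simp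
  have hcont : Continuous fun t => ‖γ (t + h) - γ t‖ := by fun_prop
  have hsplit : ∫ t in (0 : ℝ)..(2 * Real.pi), ‖γ (t + h) - γ t‖ =
      ∑ k ∈ Finset.range N, ∫ t in (0 : ℝ)..h, ‖γ (t + k * h + h) - γ (t + k * h)‖ := by
    have := intervalIntegral.sum_integral_adjacent_intervals (μ := volume)
      (f := fun t => ‖γ (t + h) - γ t‖) (a := fun k : ℕ => (k : ℝ) * h) (n := N)
      (fun k _ => hcont.intervalIntegrable _ _)
    rw [hNh] at this
    simp only [Nat.cast_zero, zero_mul] at this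
    rw [← this]
    refine Finset.sum_congr rfl fun k _ => ?_
    rw [intervalIntegral.integral_comp_add_right (fun t => ‖γ (t + h) - γ t‖)]
    congr 1 <;> push_cast <;> ring
  rw [hsplit, ← intervalIntegral.integral_finsetSum]
  · have hb : ∀ t ∈ Set.Icc (0 : ℝ) h,
        ∑ k ∈ Finset.range N, ‖γ (t + k * h + h) - γ (t + k * h)‖ ≤
          (Measure.hausdorffMeasure 1 E).toReal := by
      intro t _
      have := sum_edist_le_hausdorffMeasure hγ hC hE hinj t hN
      have h2 := ENNReal.toReal_mono hfin this
      rw [ENNReal.toReal_sum (fun _ _ => edist_ne_top _ _)] at h2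
      refine le_trans (le_of_eq ?_) h2
      refine Finset.sum_congr rfl fun k _ => ?_
      rw [edist_dist, ENNReal.toReal_ofReal dist_nonneg, dist_comm, dist_eq_norm]
      congr 3
      push_cast; ring
    have := intervalIntegral.integral_mono_on (μ := volume) hpos.le
      (f := fun t => ∑ k ∈ Finset.range N, ‖γ (t + k * h + h) - γ (t + k * h)‖)
      (g := fun _ => (Measure.hausdorffMeasure 1 E).toReal)
      (Continuous.intervalIntegrable (by fun_prop) _ _)
      (Continuous.intervalIntegrable (by fun_prop) _ _) hb
    simpa using this
  · intro k _
    exact Continuous.intervalIntegrable (by fun_prop) _ _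

/-- The pairing of a trigonometric polynomial with the derivative of a closed curve that is
injective up to countably many values is bounded by the length. -/
theorem norm_sum_fourier_le {γ : ℝ → ℂ} (hγ : Continuous γ)
    (hper : ∀ t, γ (t + 2 * Real.pi) = γ t) {C E : Set ℂ}
    (hC : C.Countable) (hE : ∀ t, γ t ∈ E)
    (hinj : ∀ s t, s < t → t < s + 2 * Real.pi → γ s = γ t → γ s ∈ C)
    (hfin : Measure.hausdorffMeasure 1 E ≠ ⊤) (J : Finset ℤ) (α : ℤ → ℂ) {M : ℝ}
    (hM : ∀ t : ℝ, ‖∑ j ∈ J, α j * Complex.exp (-(j * t * Complex.I))‖ ≤ M) :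
    ‖∑ j ∈ J, α j * (j * Complex.I) *
      ∫ t in (0 : ℝ)..(2 * Real.pi), γ t * Complex.exp (-(j * t * Complex.I))‖ ≤
      M * (Measure.hausdorffMeasure 1 E).toReal := by
  set c : ℤ → ℂ := fun j => ∫ t in (0 : ℝ)..(2 * Real.pi), γ t * Complex.exp (-(j * t * Complex.I))
    with hc
  -- Translating `γ` multiplies its Fourier coefficients by phases, so a difference quotient of `γ`
  -- acts on them as a multiplier that tends to `j * I`.
  have hshift : ∀ (j : ℤ) (h : ℝ), ∫ t in (0 : ℝ)..(2 * Real.pi),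
      γ (t + h) * Complex.exp (-(j * t * Complex.I)) = Complex.exp (j * h * Complex.I) * c j := by
    intro j h
    have hp : Function.Periodic (fun t : ℝ => γ t * Complex.exp (-(j * t * Complex.I)))
        (2 * Real.pi) := by
      intro t
      simp only [hper]
      congr 1
      rw [Complex.exp_eq_exp_iff_exists_int]
      exact ⟨-j, by push_cast; ring⟩
    have h1 := hp.intervalIntegral_add_eq h 0
    have h2 := intervalIntegral.integral_comp_add_right (a := 0) (b := 2 * Real.pi)
      (fun t : ℝ => γ t * Complex.exp (-(j * t * Complex.I))) h
    rw [zero_add] at h1 h2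
    rw [add_comm (2 * Real.pi) h, h1] at h2
    change _ = _ * ∫ t in (0 : ℝ)..(2 * Real.pi), γ t * Complex.exp (-(j * t * Complex.I))
    rw [← h2, ← intervalIntegral.integral_const_mul]
    refine intervalIntegral.integral_congr fun t _ => ?_
    rw [mul_left_comm, ← Complex.exp_add]
    congr 2
    push_cast; ring
  have key : ∀ N : ℕ, 0 < N →
      ‖∑ j ∈ J, α j * (((2 * Real.pi / N : ℝ) : ℂ)⁻¹ *
        (Complex.exp (j * (2 * Real.pi / N : ℝ) * Complex.I) - 1)) * c j‖ ≤
      M * (Measure.hausdorffMeasure 1 E).toReal := by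
    intro N hN
    set h : ℝ := 2 * Real.pi / N with hh
    have hN' : (0 : ℝ) < N := by exact_mod_cast hN
    have hpos : 0 < h := by positivity
    have hI := integral_norm_translate_sub_le hγ hC hE hinj hfin hN
    have h1 : ∑ j ∈ J, α j * (Complex.exp (j * h * Complex.I) - 1) * c j =
        ∫ t in (0 : ℝ)..(2 * Real.pi),
          (∑ j ∈ J, α j * Complex.exp (-(j * t * Complex.I))) * (γ (t + h) - γ t) := by
      simp_rw [Finset.sum_mul]
      rw [intervalIntegral.integral_finsetSum]
      · refine Finset.sum_congr rfl fun j _ => ?_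
        have h2 : ∫ t in (0 : ℝ)..(2 * Real.pi),
            α j * Complex.exp (-(j * t * Complex.I)) * (γ (t + h) - γ t) =
            ∫ t in (0 : ℝ)..(2 * Real.pi),
              α j * (γ (t + h) * Complex.exp (-(j * t * Complex.I)) -
                γ t * Complex.exp (-(j * t * Complex.I))) := by
          refine intervalIntegral.integral_congr fun t _ => ?_
          ring
        rw [h2, intervalIntegral.integral_const_mul, intervalIntegral.integral_sub, hshift]
        · simp only [hc]; ring
        · exact Continuous.intervalIntegrable (by fun_prop) _ _
        · exact Continuous.intervalIntegrable (by fun_prop) _ _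
      · intro j _
        exact Continuous.intervalIntegrable (by fun_prop) _ _
    have h3 : ‖∑ j ∈ J, α j * (Complex.exp (j * h * Complex.I) - 1) * c j‖ ≤
        M * (h * (Measure.hausdorffMeasure 1 E).toReal) := by
      have hM0 : 0 ≤ M := (norm_nonneg _).trans (hM 0)
      rw [h1]
      refine (intervalIntegral.norm_integral_le_integral_norm (by positivity)).trans ?_
      refine le_trans ?_ (mul_le_mul_of_nonneg_left hI hM0)
      rw [← intervalIntegral.integral_const_mul]
      refine intervalIntegral.integral_mono_on (by positivity)
        (Continuous.intervalIntegrable (by fun_prop) _ _)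
        (Continuous.intervalIntegrable (by fun_prop) _ _) fun t _ => ?_
      rw [norm_mul]
      exact mul_le_mul_of_nonneg_right (hM t) (norm_nonneg _)
    have h4 : ∑ j ∈ J, α j * ((h : ℂ)⁻¹ * (Complex.exp (j * h * Complex.I) - 1)) * c j =
        (h : ℂ)⁻¹ * ∑ j ∈ J, α j * (Complex.exp (j * h * Complex.I) - 1) * c j := by
      rw [Finset.mul_sum]
      exact Finset.sum_congr rfl fun j _ => by ring
    rw [h4, norm_mul, norm_inv, Complex.norm_real, Real.norm_of_nonneg hpos.le,
      inv_mul_le_iff₀ hpos]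
    linarith
  have hlim : Filter.Tendsto (fun N : ℕ => ‖∑ j ∈ J, α j * (((2 * Real.pi / N : ℝ) : ℂ)⁻¹ *
        (Complex.exp (j * (2 * Real.pi / N : ℝ) * Complex.I) - 1)) * c j‖) Filter.atTop
      (nhds ‖∑ j ∈ J, α j * (j * Complex.I) * c j‖) := by
    refine Filter.Tendsto.norm (tendsto_finsetSum _ fun j _ => ?_)
    refine Filter.Tendsto.mul_const _ (Filter.Tendsto.const_mul _ ?_)
    have hd : HasDerivAt (fun x : ℝ => Complex.exp (j * x * Complex.I)) (j * Complex.I) 0 := by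
      have h1 : HasDerivAt (fun x : ℝ => (j : ℂ) * x * Complex.I) (j * Complex.I) 0 := by
        simpa using ((Complex.ofRealCLM.hasDerivAt (x := (0:ℝ))).const_mul (j : ℂ)).mul_const
          Complex.I
      simpa using h1.cexp
    have hs := hd.tendsto_slope_zero
    have ht : Filter.Tendsto (fun N : ℕ => (2 * Real.pi / N : ℝ)) Filter.atTop
        (nhdsWithin 0 {0}ᶜ) := by
      rw [tendsto_nhdsWithin_iff]
      refine ⟨tendsto_const_div_atTop_nhds_zero_nat _, ?_⟩
      filter_upwards [Filter.eventually_gt_atTop 0] with N hN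
      have : (0 : ℝ) < N := by exact_mod_cast hN
      have : 0 < 2 * Real.pi / N := by positivity
      exact this.ne'
    refine (hs.comp ht).congr fun N => ?_
    simp [Complex.real_smul]
  exact le_of_tendsto hlim (by
    filter_upwards [Filter.eventually_gt_atTop 0] with N hN using key N hN)

/-! ### The holomorphic `n`-th root outside a level set -/

/-- The quotient `(z - b) / (z - a)` has a holomorphic logarithm on `Ω` that vanishes at infinity. -/
def HasLogQuotient (Ω : Set ℂ) (a b : ℂ) : Prop :=
  ∃ L : ℂ → ℂ, DifferentiableOn ℂ L Ω ∧ (∀ z ∈ Ω, Complex.exp (L z) * (z - a) = z - b) ∧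
    Tendsto L (cocompact ℂ) (𝓝 0)

theorem tendsto_sub_cocompact (a : ℂ) : Tendsto (fun z : ℂ => z - a) (cocompact ℂ) (cocompact ℂ) :=
  (Homeomorph.subRight a).isClosedEmbedding.tendsto_cocompact

theorem tendsto_inv_cocompact : Tendsto (fun z : ℂ => z⁻¹) (cocompact ℂ) (𝓝 0) := by
  rw [← Metric.cobounded_eq_cocompact]
  exact tendsto_inv₀_cobounded

/-- Here `(z - b) / (z - a) = 1 + (a - b) / (z - a)` lies within distance less than `1` of `1`, so
the principal logarithm works. -/
theorem HasLogQuotient.of_ball {Ω : Set ℂ} {a b : ℂ} {δ : ℝ} (hΩ : Disjoint (Metric.ball a δ) Ω)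
    (hb : b ∈ Metric.ball a δ) : HasLogQuotient Ω a b := by
  have hδ : 0 < δ := dist_nonneg.trans_lt hb
  have hfar : ∀ z ∈ Ω, δ ≤ ‖z - a‖ := by
    intro z hz
    by_contra! h
    exact Set.disjoint_left.1 hΩ (by simpa [dist_eq_norm] using h) hz
  refine ⟨fun z => Complex.log (1 + (a - b) / (z - a)), ?_, ?_, ?_⟩
  · intro z hz
    have h1 := hfar z hz
    have h2 : z - a ≠ 0 := norm_pos_iff.1 (hδ.trans_le h1)
    have h3 : 1 + (a - b) / (z - a) ∈ Complex.slitPlane := by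
      apply Complex.mem_slitPlane_of_norm_lt_one
      rw [norm_div, div_lt_one (hδ.trans_le h1)]
      rw [Metric.mem_ball', dist_eq_norm] at hb
      exact hb.trans_le h1
    refine DifferentiableAt.differentiableWithinAt (DifferentiableAt.clog ?_ h3)
    exact (differentiableAt_const _).add
      ((differentiableAt_const _).div (differentiableAt_id.sub_const a) h2)
  · intro z hz
    have h1 := hfar z hz
    have h2 : z - a ≠ 0 := norm_pos_iff.1 (hδ.trans_le h1)
    have h3 : 1 + (a - b) / (z - a) ∈ Complex.slitPlane := by
      apply Complex.mem_slitPlane_of_norm_lt_one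
      rw [norm_div, div_lt_one (hδ.trans_le h1)]
      rw [Metric.mem_ball', dist_eq_norm] at hb
      exact hb.trans_le h1
    rw [Complex.exp_log (Complex.slitPlane_ne_zero h3)]
    field_simp
    ring
  · have h1 : Tendsto (fun z : ℂ => 1 + (a - b) * (z - a)⁻¹) (cocompact ℂ) (𝓝 (1 + (a - b) * 0)) :=
      tendsto_const_nhds.add
        (tendsto_const_nhds.mul (tendsto_inv_cocompact.comp (tendsto_sub_cocompact a)))
    rw [mul_zero, add_zero] at h1
    have h2 := (continuousAt_clog Complex.one_mem_slitPlane).tendsto.comp h1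
    simpa [Function.comp_def, div_eq_mul_inv] using h2

/-- The relation is symmetric and transitive, by negating and adding logarithms, and holds between
nearby points; on a connected set it therefore holds between any two. -/
theorem HasLogQuotient.of_isPreconnected {U S Ω : Set ℂ} (hU : IsOpen U) (hUΩ : Disjoint U Ω)
    (hS : IsPreconnected S) (hSU : S ⊆ U) {a b : ℂ} (ha : a ∈ S) (hb : b ∈ S) :
    HasLogQuotient Ω a b := by
  refine hS.induction₂ (HasLogQuotient Ω) ?_ ?_ ?_ ha hb
  · intro x hx
    obtain ⟨δ, hδ, hball⟩ := Metric.isOpen_iff.1 hU x (hSU hx)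
    filter_upwards [mem_nhdsWithin_of_mem_nhds (Metric.ball_mem_nhds x hδ)] with y hy
    exact HasLogQuotient.of_ball (hUΩ.mono_left hball) hy
  · rintro x y z - - - ⟨L, h1, h2, h3⟩ ⟨M, g1, g2, g3⟩
    refine ⟨fun z => M z + L z, g1.add h1, fun w hw => ?_, by simpa using g3.add h3⟩
    rw [Complex.exp_add, mul_assoc, h2 w hw, g2 w hw]
  · rintro x y - - ⟨L, h1, h2, h3⟩
    refine ⟨fun z => -L z, h1.neg, fun w hw => ?_, by simpa using h3.neg⟩
    rw [← h2 w hw, ← mul_assoc, ← Complex.exp_add]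
    simp

/-- Every zero can be joined to the lemniscate inside the filled lemniscate. -/
theorem exists_isPreconnected_of_isRoot {P : ℂ[X]} (hP : 0 < P.degree) {a : ℂ}
    (ha : P.eval a = 0) :
    ∃ S : Set ℂ, IsPreconnected S ∧ a ∈ S ∧ (∀ z ∈ S, ‖P.eval z‖ ≤ 1) ∧
      ∃ e ∈ S, ‖P.eval e‖ = 1 := by
  set f : ℝ → ℝ := fun t => ‖P.eval (a + t)‖ with hf
  have hfc : Continuous f := by
    have := P.continuous
    fun_prop
  have hlim : Tendsto f atTop atTop := by
    refine P.tendsto_norm_atTop hP ?_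
    refine tendsto_norm_cocompact_atTop.comp ?_
    have h1 : Tendsto (fun t : ℝ => (t : ℂ)) atTop (cocompact ℂ) :=
      Complex.isometry_ofReal.isClosedEmbedding.tendsto_cocompact.mono_left
        atTop_le_cocompact
    exact (Homeomorph.addLeft a).isClosedEmbedding.tendsto_cocompact.comp h1
  -- Follow a horizontal ray from the zero up to the first time that `|P| = 1`; before it `|P|`
  -- cannot exceed `1`, by the intermediate value theorem.
  set T : Set ℝ := Set.Ici 0 ∩ f ⁻¹' {1} with hT
  have hTc : IsClosed T := isClosed_Ici.inter (isClosed_singleton.preimage hfc)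
  have hTne : T.Nonempty := by
    obtain ⟨t1, ht1, ht2⟩ := ((hlim.eventually_ge_atTop 1).and (eventually_ge_atTop 0)).exists
    have := intermediate_value_Icc ht2 hfc.continuousOn
    obtain ⟨t, ht, h1⟩ := this (show (1 : ℝ) ∈ Set.Icc (f 0) (f t1) by simp [hf, ha]; exact ht1)
    exact ⟨t, ht.1, h1⟩
  have hbdd : BddBelow T := ⟨0, fun t ht => ht.1⟩
  have hmem := hTc.csInf_mem hTne hbdd
  refine ⟨(fun t : ℝ => a + t) '' Set.Icc 0 (sInf T), isPreconnected_Icc.image _ (by fun_prop),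
    ⟨0, by simpa using hmem.1, by simp⟩, ?_, ⟨_, ⟨sInf T, ⟨hmem.1, le_rfl⟩, rfl⟩, hmem.2⟩⟩
  rintro _ ⟨t, ht, rfl⟩
  by_contra! h
  obtain ⟨s, hs, h1⟩ := intermediate_value_Icc ht.1 hfc.continuousOn
    (show (1 : ℝ) ∈ Set.Icc (f 0) (f t) from ⟨by simp [hf, ha], h.le⟩)
  have h2 : sInf T ≤ s := csInf_le hbdd ⟨hs.1, h1⟩
  have h3 : s = t := le_antisymm hs.2 (ht.2.trans h2)
  rw [h3] at h1
  exact h.ne' h1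

/-- The part of the plane outside the level `r` of `|P|`. -/
def outside (P : ℂ[X]) (r : ℝ) : Set ℂ := {z | r < ‖P.eval z‖}

theorem isOpen_outside (P : ℂ[X]) (r : ℝ) : IsOpen (outside P r) :=
  isOpen_lt continuous_const P.continuous.norm

/-- The connected lemniscate joins the two segments that run from the zeros to it. Taking `r > 1`
leaves an open neighbourhood of their union disjoint from the exterior. -/
theorem IsKPolynomial.hasLogQuotient {P : ℂ[X]} (hK : IsKPolynomial P) (hP : 0 < P.degree)
    {r : ℝ} (hr : 1 < r) {a b : ℂ} (ha : P.eval a = 0) (hb : P.eval b = 0) :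
    HasLogQuotient (outside P r) a b := by
  obtain ⟨S, hS, haS, hS1, e, heS, he⟩ := exists_isPreconnected_of_isRoot hP ha
  obtain ⟨T, hT, hbT, hT1, f, hfT, hf⟩ := exists_isPreconnected_of_isRoot hP hb
  rw [← mem_lemniscate_zero_iff] at he hf
  have h1 : IsPreconnected (S ∪ lemniscate P 0) := hS.union e heS he hK.isPreconnected
  have h2 : IsPreconnected (S ∪ lemniscate P 0 ∪ T) := h1.union f (Or.inr hf) hfT hT
  refine HasLogQuotient.of_isPreconnected (U := {z | ‖P.eval z‖ < r})
    (isOpen_lt P.continuous.norm continuous_const) ?_ h2 ?_ (Or.inl (Or.inl haS)) (Or.inr hbT)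
  · rw [Set.disjoint_left]
    intro z hz hz2
    exact lt_asymm (show ‖P.eval z‖ < r from hz) hz2
  · rintro z ((hz | hz) | hz)
    · exact (hS1 z hz).trans_lt hr
    · rw [mem_lemniscate_zero_iff] at hz
      exact hz.trans_lt hr
    · exact (hT1 z hz).trans_lt hr

theorem exists_log_prod {Ω : Set ℂ} {a : ℂ} (s : Multiset ℂ) (h : ∀ b ∈ s, HasLogQuotient Ω a b) :
    ∃ L : ℂ → ℂ, DifferentiableOn ℂ L Ω ∧
      (∀ z ∈ Ω, Complex.exp (L z) * (z - a) ^ s.card = (s.map fun b => z - b).prod) ∧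
      Tendsto L (cocompact ℂ) (𝓝 0) := by
  induction s using Multiset.induction_on with
  | empty => exact ⟨fun _ => 0, differentiableOn_const _, by simp, tendsto_const_nhds⟩
  | cons b s ih =>
    obtain ⟨L, h1, h2, h3⟩ := ih fun b hb => h b (Multiset.mem_cons_of_mem hb)
    obtain ⟨M, g1, g2, g3⟩ := h b (Multiset.mem_cons_self b s)
    refine ⟨fun z => M z + L z, g1.add h1, fun w hw => ?_, by simpa using g3.add h3⟩
    rw [Multiset.map_cons, Multiset.prod_cons, ← h2 w hw, ← g2 w hw, Complex.exp_add,
      Multiset.card_cons]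
    ring

/-- A connected lemniscate admits a holomorphic `n`-th root of `P` in its exterior. -/
theorem IsKPolynomial.exists_root {P : ℂ[X]} (hK : IsKPolynomial P) (hP : P.Monic)
    (hdeg : 1 ≤ P.natDegree) {r : ℝ} (hr : 1 < r) :
    ∃ Φ : ℂ → ℂ, DifferentiableOn ℂ Φ (outside P r) ∧
      (∀ z ∈ outside P r, Φ z ^ P.natDegree = P.eval z) ∧
      Tendsto (fun z => Φ z / z) (cocompact ℂ) (𝓝 1) := by
  have hd : 0 < P.degree := natDegree_pos_iff_degree_pos.1 hdeg
  obtain ⟨a, ha⟩ := IsAlgClosed.exists_root P hd.ne'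
  have hsp : P.Splits := IsAlgClosed.splits P
  obtain ⟨L, h1, h2, h3⟩ := exists_log_prod (Ω := outside P r) (a := a) P.roots (by
    intro b hb
    exact hK.hasLogQuotient hd hr ha (isRoot_of_mem_roots hb))
  have hn : (P.natDegree : ℂ) ≠ 0 := by exact_mod_cast (by omega : P.natDegree ≠ 0)
  -- With `P = (z - a) ^ n * exp L`, dividing `L` by `n` gives the root; `L → 0` at infinity fixes
  -- the branch.
  refine ⟨fun z => (z - a) * Complex.exp (L z / P.natDegree), ?_, ?_, ?_⟩
  · exact (differentiableOn_id.sub_const a).mul (h1.div_const _).cexp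
  · intro z hz
    rw [mul_pow, ← Complex.exp_nat_mul, mul_div_cancel₀ _ hn,
      hsp.eval_eq_prod_roots_of_monic hP, ← h2 z hz, ← hsp.natDegree_eq_card_roots, mul_comm]
  · have h4 : Tendsto (fun z : ℂ => 1 - a * z⁻¹) (cocompact ℂ) (𝓝 (1 - a * 0)) :=
      tendsto_const_nhds.sub (tendsto_const_nhds.mul tendsto_inv_cocompact)
    have h5 := h4.mul ((Complex.continuous_exp.tendsto _).comp (h3.div_const (P.natDegree : ℂ)))
    simp only [mul_zero, sub_zero, zero_div, Complex.exp_zero, mul_one] at h5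
    refine h5.congr' ?_
    have h6 : ∀ᶠ z : ℂ in cocompact ℂ, z ≠ 0 :=
      (tendsto_norm_cocompact_atTop.eventually_gt_atTop 0).mono fun z hz => norm_pos_iff.1 hz
    filter_upwards [h6] with z hz
    simp only [Function.comp_apply]
    field_simp

/-! ### The exterior conformal map -/

theorem isPreconnected_norm_gt {r : ℝ} (hr : 0 < r) : IsPreconnected {w : ℂ | r < ‖w‖} := by
  have h : {w : ℂ | r < ‖w‖} = Complex.exp '' {s : ℂ | Real.log r < s.re} := by
    ext w
    constructor
    · intro hw
      have h0 : 0 < ‖w‖ := hr.trans hw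
      refine ⟨Complex.log w, ?_, Complex.exp_log (norm_pos_iff.1 h0)⟩
      rw [Set.mem_ofPred_eq, Complex.log_re]
      exact Real.log_lt_log hr hw
    · rintro ⟨s, hs, rfl⟩
      rw [Set.mem_ofPred_eq, Complex.norm_exp]
      exact (Real.log_lt_iff_lt_exp hr).1 hs
  rw [h]
  exact (convex_halfSpace_re_gt _).isPreconnected.image _ Complex.continuous_exp.continuousOn

/-- The inverse of a normalised `n`-th root of `P` on the exterior of a level set. -/
theorem IsKPolynomial.exists_inverse {P : ℂ[X]} (hK : IsKPolynomial P) (hP : P.Monic)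
    (hdeg : 1 ≤ P.natDegree) {ρ : ℝ} (hρ : 1 < ρ) :
    ∃ Φ Ψ : ℂ → ℂ, ContinuousOn Φ (outside P (ρ ^ P.natDegree)) ∧
      (∀ z ∈ outside P (ρ ^ P.natDegree), Φ z ^ P.natDegree = P.eval z) ∧
      (∀ z ∈ outside P (ρ ^ P.natDegree), Ψ (Φ z) = z) ∧
      Tendsto (fun z => Φ z / z) (cocompact ℂ) (𝓝 1) ∧
      DifferentiableOn ℂ Ψ {w | ρ < ‖w‖} ∧
      (∀ w, ρ < ‖w‖ → Φ (Ψ w) = w) ∧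
      (∀ w, ρ < ‖w‖ → P.eval (Ψ w) = w ^ P.natDegree) := by
  set n := P.natDegree with hn
  have hn0 : n ≠ 0 := by omega
  have hd : 0 < P.degree := natDegree_pos_iff_degree_pos.1 hdeg
  have hρ0 : 0 < ρ := by linarith
  obtain ⟨Φ, hΦd, hΦP, hΦ1⟩ := hK.exists_root hP hdeg (one_lt_pow₀ hρ hn0)
  rw [← hn] at hΦP
  set Ω := outside P (ρ ^ n) with hΩ
  have hΩo : IsOpen Ω := isOpen_outside _ _
  have hΦΩ : ∀ z ∈ Ω, ρ < ‖Φ z‖ := by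
    intro z hz
    have h1 : ρ ^ n < ‖P.eval z‖ := hz
    rw [← hΦP z hz, norm_pow] at h1
    exact lt_of_pow_lt_pow_left₀ n (norm_nonneg _) h1
  -- Open mapping theorem: were `Φ` locally constant, so would be its power `P`.
  have hopen : ∀ z ∈ Ω, 𝓝 (Φ z) ≤ map Φ (𝓝 z) := by
    intro z hz
    have han : AnalyticAt ℂ Φ z := hΦd.analyticAt (hΩo.mem_nhds hz)
    refine han.eventually_constant_or_nhds_le_map_nhds.resolve_left fun hconst => ?_
    have h1 : ∀ᶠ y in 𝓝 z, (P - C (P.eval z)).eval y = 0 := by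
      filter_upwards [hconst, hΩo.mem_nhds hz] with y hy hyΩ
      rw [eval_sub, eval_C, ← hΦP y hyΩ, ← hΦP z hz, hy, sub_self]
    have h2 : P - C (P.eval z) = 0 := by
      refine Polynomial.eq_zero_of_infinite_isRoot _ ?_
      exact infinite_of_mem_nhds z h1
    have h3 : P = C (P.eval z) := sub_eq_zero.1 h2
    rw [h3] at hd
    exact absurd hd (not_lt.2 degree_C_le)
  have hcob : Tendsto (fun z => ‖P.eval z‖) (cocompact ℂ) atTop :=
    P.tendsto_norm_atTop hd tendsto_norm_cocompact_atTop
  -- The image is open, and relatively closed because `P` is proper; the target is connected.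
  have hsurj : {w : ℂ | ρ < ‖w‖} ⊆ Φ '' Ω := by
    refine (isPreconnected_norm_gt hρ0).subset_of_closure_inter_subset ?_ ?_ ?_
    · rw [isOpen_iff_mem_nhds]
      rintro _ ⟨z, hz, rfl⟩
      exact hopen z hz (image_mem_map (hΩo.mem_nhds hz))
    · obtain ⟨z, hz⟩ := (hcob.eventually_gt_atTop (ρ ^ n)).exists
      exact ⟨Φ z, hΦΩ z hz, z, hz, rfl⟩
    · rintro w ⟨hw, hwρ⟩
      obtain ⟨u, hu, hulim⟩ := mem_closure_iff_seq_limit.1 hw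
      choose z hz hzu using hu
      have hPz : ∀ k, P.eval (z k) = u k ^ n := fun k => by rw [← hzu k, hΦP _ (hz k)]
      have hlim : Tendsto (fun k => P.eval (z k)) atTop (𝓝 (w ^ n)) := by
        simp_rw [hPz]; exact hulim.pow n
      have hcomp : IsCompact {z : ℂ | ‖P.eval z‖ ≤ ‖w ^ n‖ + 1} := by
        refine Metric.isCompact_of_isClosed_isBounded
          (isClosed_le P.continuous.norm continuous_const) ?_
        have := hcob.eventually_gt_atTop (‖w ^ n‖ + 1)
        rw [Metric.cobounded_eq_cocompact.symm] at this
        rw [Bornology.isBounded_def]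
        filter_upwards [this] with y hy
        simpa using hy
      have hev : ∀ᶠ k in atTop, z k ∈ {z : ℂ | ‖P.eval z‖ ≤ ‖w ^ n‖ + 1} := by
        filter_upwards [hlim.norm.eventually_lt_const (lt_add_one _)] with k hk
        exact le_of_lt hk
      obtain ⟨y, -, φ, hφ, hy⟩ := hcomp.tendsto_subseq' hev.frequently
      have hPy : P.eval y = w ^ n :=
        tendsto_nhds_unique ((P.continuous.tendsto y).comp hy) (hlim.comp hφ.tendsto_atTop)
      have hyΩ : y ∈ Ω := by
        change ρ ^ n < ‖P.eval y‖
        rw [hPy, norm_pow]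
        exact pow_lt_pow_left₀ hwρ hρ0.le hn0
      refine ⟨y, hyΩ, ?_⟩
      have h1 := ((hΦd.continuousOn.continuousAt (hΩo.mem_nhds hyΩ)).tendsto).comp hy
      refine tendsto_nhds_unique h1 ?_
      refine (hulim.comp hφ.tendsto_atTop).congr fun k => ?_
      simp [hzu]
  have hsurj' : ∀ w : ℂ, ρ < ‖w‖ → ∃ z, z ∈ Ω ∧ Φ z = w := fun w hw => hsurj hw
  choose! Ψ hΨΩ hΦΨ using hsurj'
  have hPΨ : ∀ w, ρ < ‖w‖ → P.eval (Ψ w) = w ^ n := fun w hw => by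
    rw [← hΦP _ (hΨΩ _ hw), hΦΨ _ hw]
  have hprim : IsPrimitiveRoot (Complex.exp (2 * Real.pi * Complex.I / n)) n :=
    Complex.isPrimitiveRoot_exp n hn0
  -- The points `Ψ (ζ * w)` with `ζ ^ n = 1` are `n` distinct roots of `P - w ^ n`, as `Φ` separates
  -- them. They are thus all its roots, and simple; this gives both injectivity of `Φ` and `P' ≠ 0`
  -- at `Ψ w`.
  have hroots : ∀ w : ℂ, ρ < ‖w‖ → (P - C (w ^ n)).natDegree = n ∧ (P - C (w ^ n)) ≠ 0 ∧
      ((nthRootsFinset n (1 : ℂ)).image fun ζ => Ψ (ζ * w)) =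
        (P - C (w ^ n)).roots.toFinset ∧ (P - C (w ^ n)).roots.Nodup := by
    intro w hw
    have hw0 : w ≠ 0 := norm_pos_iff.1 (hρ0.trans hw)
    have hdeg' : (P - C (w ^ n)).natDegree = n := natDegree_sub_C
    have hne : (P - C (w ^ n)) ≠ 0 := by
      intro h; rw [h, natDegree_zero] at hdeg'; exact hn0 hdeg'.symm
    have hζ : ∀ ζ ∈ nthRootsFinset n (1 : ℂ), ζ ^ n = 1 ∧ ρ < ‖ζ * w‖ := by
      intro ζ hζ
      have h1 : ζ ^ n = 1 := (mem_nthRootsFinset (by omega) _).1 hζ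
      refine ⟨h1, ?_⟩
      rw [norm_mul, Complex.norm_eq_one_of_pow_eq_one h1 hn0, one_mul]
      exact hw
    have hsub : ((nthRootsFinset n (1 : ℂ)).image fun ζ => Ψ (ζ * w)) ⊆
        (P - C (w ^ n)).roots.toFinset := by
      intro z hz
      obtain ⟨ζ, hζ1, rfl⟩ := Finset.mem_image.1 hz
      rw [Multiset.mem_toFinset, mem_roots hne, IsRoot.def, eval_sub, eval_C,
        hPΨ _ (hζ ζ hζ1).2, mul_pow, (hζ ζ hζ1).1, one_mul, sub_self]
    have hcard : ((nthRootsFinset n (1 : ℂ)).image fun ζ => Ψ (ζ * w)).card = n := by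
      rw [Finset.card_image_of_injOn, hprim.card_nthRootsFinset]
      intro ζ hζ1 ξ hξ h
      have h1 := congrArg Φ h
      simp only at h1
      rw [hΦΨ _ (hζ ζ hζ1).2, hΦΨ _ (hζ ξ hξ).2] at h1
      exact mul_right_cancel₀ hw0 h1
    have hle : (P - C (w ^ n)).roots.toFinset.card ≤ (P - C (w ^ n)).roots.card :=
      Multiset.toFinset_card_le _
    have hle2 : (P - C (w ^ n)).roots.card ≤ n := (card_roots' _).trans hdeg'.le
    have heq := Finset.eq_of_subset_of_card_le hsub (by omega)
    refine ⟨hdeg', hne, heq, ?_⟩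
    rw [← Multiset.toFinset_card_eq_card_iff_nodup, ← heq, hcard]
    rw [← heq, hcard] at hle
    omega
  have hleft : ∀ z ∈ Ω, Ψ (Φ z) = z := by
    intro z hz
    have hw := hΦΩ z hz
    obtain ⟨-, hne, heq, -⟩ := hroots _ hw
    have h1 : z ∈ (P - C (Φ z ^ n)).roots.toFinset := by
      rw [Multiset.mem_toFinset, mem_roots hne, IsRoot.def, eval_sub, eval_C, hΦP z hz, sub_self]
    rw [← heq, Finset.mem_image] at h1
    obtain ⟨ζ, hζ, h2⟩ := h1
    have h1 : ζ ^ n = 1 := (mem_nthRootsFinset (by omega) _).1 hζ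
    have h3 : ρ < ‖ζ * Φ z‖ := by
      rw [norm_mul, Complex.norm_eq_one_of_pow_eq_one h1 hn0, one_mul]; exact hw
    have h4 := hΦΨ _ h3
    rw [h2] at h4
    rwa [← h4] at h2
  refine ⟨Φ, Ψ, hΦd.continuousOn, hΦP, hleft, hΦ1, ?_, fun w hw => hΦΨ _ hw, hPΨ⟩
  intro w hw
  have hw0 : w ≠ 0 := norm_pos_iff.1 (hρ0.trans hw)
  have hWo : IsOpen {w : ℂ | ρ < ‖w‖} := isOpen_lt continuous_const continuous_norm
  have hcont : ContinuousAt Ψ w := by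
    intro V hV
    have h1 := hopen _ (hΨΩ _ hw) (image_mem_map (inter_mem hV (hΩo.mem_nhds (hΨΩ _ hw))))
    rw [hΦΨ _ hw] at h1
    rw [mem_map]
    filter_upwards [h1]
    rintro _ ⟨z, ⟨hz, hzΩ⟩, rfl⟩
    rw [Set.mem_preimage, hleft z hzΩ]
    exact hz
  have hPd : (derivative P).eval (Ψ w) ≠ 0 := by
    obtain ⟨-, hne, -, hnd⟩ := hroots w hw
    intro h0
    have hroot : (P - C (w ^ n)).IsRoot (Ψ w) := by
      rw [IsRoot.def, eval_sub, eval_C, hPΨ w hw, sub_self]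
    have h1 : 1 < (P - C (w ^ n)).rootMultiplicity (Ψ w) := by
      rw [one_lt_rootMultiplicity_iff_isRoot hne]
      exact ⟨hroot, by rwa [derivative_sub, derivative_C, sub_zero]⟩
    rw [← count_roots] at h1
    exact absurd h1 (not_lt.2 (Multiset.nodup_iff_count_le_one.1 hnd _))
  have hΦat : DifferentiableAt ℂ Φ (Ψ w) := (hΦd _ (hΨΩ _ hw)).differentiableAt (hΩo.mem_nhds (hΨΩ _ hw))
  have hder : deriv Φ (Ψ w) ≠ 0 := by
    intro h0
    have h1 := hΦat.hasDerivAt.pow n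
    rw [h0, mul_zero] at h1
    have h2 : HasDerivAt (fun z => P.eval z) 0 (Ψ w) := by
      refine h1.congr_of_eventuallyEq ?_
      filter_upwards [hΩo.mem_nhds (hΨΩ _ hw)] with z hz
      exact (hΦP z hz).symm
    exact hPd ((P.hasDerivAt _).unique h2)
  refine (HasDerivAt.of_local_left_inverse hcont hΦat.hasDerivAt hder ?_).differentiableAt
    |>.differentiableWithinAt
  filter_upwards [hWo.mem_nhds hw] with v hv using hΦΨ _ hv

theorem tendsto_norm_of_eval_eq_pow {P : ℂ[X]} (hdeg : 1 ≤ P.natDegree) {ρ : ℝ} {Ψ : ℂ → ℂ}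
    (h : ∀ w, ρ < ‖w‖ → P.eval (Ψ w) = w ^ P.natDegree) :
    Tendsto Ψ (cocompact ℂ) (cocompact ℂ) := by
  have hn0 : P.natDegree ≠ 0 := by omega
  rw [← Metric.cobounded_eq_cocompact, ← tendsto_norm_atTop_iff_cobounded, tendsto_atTop]
  intro R
  obtain ⟨M, hM⟩ := (isCompact_closedBall (0 : ℂ) R).exists_bound_of_continuousOn
    P.continuous.continuousOn
  have h1 : Tendsto (fun w : ℂ => ‖w‖ ^ P.natDegree) (Bornology.cobounded ℂ) atTop :=
    (tendsto_pow_atTop hn0).comp tendsto_norm_cobounded_atTop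
  filter_upwards [h1.eventually_gt_atTop M, tendsto_norm_cobounded_atTop.eventually_gt_atTop ρ]
    with w hw hwρ
  by_contra! hlt
  have h2 := hM (Ψ w) (by simpa using hlt.le)
  rw [h w hwρ, norm_pow] at h2
  exact absurd hw (not_lt.2 h2)

/-- The normalised inverse `n`-th root on the whole exterior of the lemniscate. -/
theorem IsKPolynomial.exists_exterior_map {P : ℂ[X]} (hK : IsKPolynomial P) (hP : P.Monic)
    (hdeg : 1 ≤ P.natDegree) :
    ∃ Ψ : ℂ → ℂ, DifferentiableOn ℂ Ψ {w | 1 < ‖w‖} ∧ Set.InjOn Ψ {w | 1 < ‖w‖} ∧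
      (∀ w, 1 < ‖w‖ → P.eval (Ψ w) = w ^ P.natDegree) ∧
      Tendsto (fun w => Ψ w / w) (cocompact ℂ) (𝓝 1) := by
  set n := P.natDegree with hn
  have hn0 : n ≠ 0 := by omega
  have H := fun (ρ : ℝ) (hρ : 1 < ρ) => hK.exists_inverse hP hdeg hρ
  rw [← hn] at H
  choose! Φ Ψ hΦc hΦP hleft hΦ1 hΨd hΦΨ hPΨ using H
  have hlim : ∀ ρ, 1 < ρ → Tendsto (fun w => w / Ψ ρ w) (cocompact ℂ) (𝓝 1) := by
    intro ρ hρ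
    have h1 := (hΦ1 ρ hρ).comp (tendsto_norm_of_eval_eq_pow hdeg (hPΨ ρ hρ))
    refine h1.congr' ?_
    filter_upwards [tendsto_norm_cocompact_atTop.eventually_gt_atTop ρ] with w hw
    simp only [Function.comp_apply]
    rw [hΦΨ ρ hρ w hw]
  have hmem : ∀ σ ρ, 1 < σ → σ ≤ ρ → ∀ w, ρ < ‖w‖ → Ψ ρ w ∈ outside P (σ ^ n) := by
    intro σ ρ hσ hσρ w hw
    change σ ^ n < ‖P.eval _‖
    rw [hPΨ ρ (hσ.trans_le hσρ) w hw, norm_pow]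
    exact pow_lt_pow_left₀ (hσρ.trans_lt hw) (by linarith) hn0
  -- The ratio `Φ σ (Ψ ρ v) / v` is a continuous `n`-th root of unity on a connected set, hence
  -- constant, and its limit at infinity is `1`.
  have hcompat : ∀ σ ρ, 1 < σ → σ ≤ ρ → ∀ w, ρ < ‖w‖ → Ψ σ w = Ψ ρ w := by
    intro σ ρ hσ hσρ w hw
    have hρ : 1 < ρ := hσ.trans_le hσρ
    have hne : ∀ v : ℂ, ρ < ‖v‖ → v ≠ 0 := fun v hv => norm_pos_iff.1 (by linarith)
    have hcont : ContinuousOn (fun v => Φ σ (Ψ ρ v) / v) {v | ρ < ‖v‖} :=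
      ((hΦc σ hσ).comp (hΨd ρ hρ).continuousOn (hmem σ ρ hσ hσρ)).div continuousOn_id hne
    have hfin : (↑(nthRootsFinset n (1 : ℂ)) : Set ℂ).Finite := Finset.finite_toSet _
    have hmaps : Set.MapsTo (fun v => Φ σ (Ψ ρ v) / v) {v | ρ < ‖v‖} (nthRootsFinset n (1 : ℂ)) := by
      intro v hv
      rw [Finset.mem_coe, mem_nthRootsFinset (by omega), div_pow,
        hΦP σ hσ _ (hmem σ ρ hσ hσρ v hv), hPΨ ρ hρ v hv, div_self (pow_ne_zero _ (hne v hv))]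
    obtain ⟨c, -, hc⟩ := (isPreconnected_norm_gt (by linarith : 0 < ρ)).eqOn_const_of_mapsTo
      hfin.isDiscrete hcont hmaps ⟨1, by simp [mem_nthRootsFinset (show 0 < n by omega)]⟩
    have h1 : Tendsto (fun v => Φ σ (Ψ ρ v) / v) (cocompact ℂ) (𝓝 1) := by
      have h2 := (hΦ1 σ hσ).comp (tendsto_norm_of_eval_eq_pow hdeg (hPΨ ρ hρ))
      have h3 := h2.div (hlim ρ hρ) one_ne_zero
      rw [div_one] at h3
      refine h3.congr' ?_
      filter_upwards [tendsto_norm_cocompact_atTop.eventually_gt_atTop ρ,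
        (hlim ρ hρ).eventually_ne one_ne_zero] with v hv hv2
      have h5 : Ψ ρ v ≠ 0 := fun h => hv2 (by rw [h, div_zero])
      simp only [Pi.div_apply, Function.comp_apply]
      field_simp
    have hc1 : c = 1 := by
      refine tendsto_nhds_unique (tendsto_const_nhds.congr' ?_) h1
      filter_upwards [tendsto_norm_cocompact_atTop.eventually_gt_atTop ρ] with v hv
      exact (hc hv).symm
    have h6 : Φ σ (Ψ ρ w) / w = 1 := (hc hw).trans hc1
    rw [div_eq_one_iff_eq (hne w hw)] at h6
    rw [← hleft σ hσ _ (hmem σ ρ hσ hσρ w hw), h6]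
  -- Any radius strictly between `1` and `‖w‖` would do; the midpoint is a definite choice.
  set F : ℂ → ℂ := fun w => Ψ ((1 + ‖w‖) / 2) w with hF
  have hFΨ : ∀ ρ, 1 < ρ → ∀ w, ρ < ‖w‖ → F w = Ψ ρ w := by
    intro ρ hρ w hw
    rcases le_total ((1 + ‖w‖) / 2) ρ with h | h
    · exact hcompat _ _ (by linarith) h w hw
    · exact (hcompat _ _ hρ h w (by linarith)).symm
  have hmid : ∀ x : ℝ, 1 < x → 1 < (1 + x) / 2 ∧ (1 + x) / 2 < x :=
    fun x hx => ⟨by linarith, by linarith⟩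
  refine ⟨F, ?_, ?_, ?_, ?_⟩
  · intro w hw
    obtain ⟨h1, h2⟩ := hmid ‖w‖ hw
    have hmem : {v : ℂ | (1 + ‖w‖) / 2 < ‖v‖} ∈ 𝓝 w :=
      (isOpen_lt continuous_const continuous_norm).mem_nhds h2
    have h3 := ((hΨd _ h1) w h2).differentiableAt hmem
    refine (h3.congr_of_eventuallyEq ?_).differentiableWithinAt
    filter_upwards [hmem] with v hv using hFΨ _ h1 v hv
  · intro w hw v hv h
    obtain ⟨h1, h2⟩ := hmid (min ‖w‖ ‖v‖) (lt_min hw hv)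
    have hw' := h2.trans_le (min_le_left _ _)
    have hv' := h2.trans_le (min_le_right _ _)
    rw [hFΨ _ h1 w hw', hFΨ _ h1 v hv'] at h
    rw [← hΦΨ _ h1 w hw', h, hΦΨ _ h1 v hv']
  · intro w hw
    obtain ⟨h1, h2⟩ := hmid ‖w‖ hw
    exact hPΨ _ h1 w h2
  · have h1 := (hlim 2 one_lt_two).inv₀ one_ne_zero
    rw [inv_one] at h1
    refine h1.congr' ?_
    filter_upwards [tendsto_norm_cocompact_atTop.eventually_gt_atTop 2] with w hw
    rw [inv_div, hFΨ 2 one_lt_two w hw]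

/-! ### Boundary values of the exterior map -/

/-- A lift of a convergent curve through a polynomial converges. -/
theorem exists_tendsto_of_tendsto_eval {P : ℂ[X]} (hdeg : 1 ≤ P.natDegree) {G : ℂ → ℂ} {H : Set ℂ}
    (hH : Convex ℝ H) (hG : ContinuousOn G H) {s c : ℂ} (hs : s ∈ closure H)
    (hlim : Tendsto (fun x => P.eval (G x)) (𝓝[H] s) (𝓝 c)) :
    ∃ y, Tendsto G (𝓝[H] s) (𝓝 y) := by
  have hd : 0 < P.degree := natDegree_pos_iff_degree_pos.1 hdeg
  have : (𝓝[H] s).NeBot := mem_closure_iff_nhdsWithin_neBot.1 hs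
  have hcomp : IsCompact {z : ℂ | ‖P.eval z‖ ≤ ‖c‖ + 1} := by
    refine Metric.isCompact_of_isClosed_isBounded
      (isClosed_le P.continuous.norm continuous_const) ?_
    have := (P.tendsto_norm_atTop hd tendsto_norm_cocompact_atTop).eventually_gt_atTop (‖c‖ + 1)
    rw [Metric.cobounded_eq_cocompact.symm] at this
    rw [Bornology.isBounded_def]
    filter_upwards [this] with y hy
    simpa using hy
  have hev : ∀ᶠ x in 𝓝[H] s, G x ∈ {z : ℂ | ‖P.eval z‖ ≤ ‖c‖ + 1} := by
    filter_upwards [hlim.norm.eventually_lt_const (lt_add_one _)] with x hx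
    exact le_of_lt hx
  -- Cluster points of `G` are among the finitely many roots of `P - c`. Two of them could be
  -- separated by open sets, contradicting connectedness of the image of a small convex
  -- neighbourhood.
  have hclus : ∀ y, MapClusterPt y (𝓝[H] s) G → P.eval y = c := by
    intro y hy
    have h1 : MapClusterPt (P.eval y) (𝓝[H] s) (fun x => P.eval (G x)) :=
      hy.continuousAt_comp P.continuous.continuousAt
    have h2 : ClusterPt (P.eval y) (𝓝 c) := h1.clusterPt.mono hlim
    exact (eq_of_nhds_neBot h2)
  obtain ⟨y, -, hy⟩ := hcomp.exists_mapClusterPt_of_frequently hev.frequently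
  refine ⟨y, hcomp.tendsto_nhds_of_unique_mapClusterPt hev fun z _ hz => ?_⟩
  by_contra hzy
  have hne : P - C c ≠ 0 := by
    intro h
    have h3 : P = C c := sub_eq_zero.1 h
    rw [h3] at hd
    exact absurd hd (not_lt.2 degree_C_le)
  set R : Set ℂ := {x | (P - C c).IsRoot x} with hR
  have hRfin : R.Finite := Polynomial.finite_setOfPred_isRoot hne
  have hRmem : ∀ x, P.eval x = c → x ∈ R := by
    intro x hx
    change (P - C c).IsRoot x
    rw [IsRoot.def, eval_sub, eval_C, hx, sub_self]
  obtain ⟨u, v, hu, hv, hyu, hRv, huv⟩ : SeparatedNhds {y} (R \ {y}) :=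
    SeparatedNhds.of_isCompact_isCompact isCompact_singleton hRfin.sdiff.isCompact (by simp)
  have hevuv : ∀ᶠ x in 𝓝[H] s, G x ∈ u ∪ v := by
    by_contra hcon
    have hfr : ∃ᶠ x in 𝓝[H] s, G x ∈ {z : ℂ | ‖P.eval z‖ ≤ ‖c‖ + 1} \ (u ∪ v) := by
      have h1 := (not_eventually.1 hcon).and_eventually hev
      exact h1.mono fun x hx => ⟨hx.2, hx.1⟩
    obtain ⟨x, hx, hxc⟩ := (hcomp.diff (hu.union hv)).exists_mapClusterPt_of_frequently hfr
    have h2 := hRmem x (hclus x hxc)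
    by_cases hxy : x = y
    · exact hx.2 (Or.inl (hyu hxy))
    · exact hx.2 (Or.inr (hRv ⟨h2, hxy⟩))
  obtain ⟨δ, hδ, hball⟩ := Metric.mem_nhdsWithin_iff.1 hevuv
  have hconn : IsPreconnected (G '' (Metric.ball s δ ∩ H)) :=
    ((convex_ball s δ).inter hH).isPreconnected.image _ (hG.mono Set.inter_subset_right)
  have hnb : Metric.ball s δ ∩ H ∈ 𝓝[H] s :=
    inter_mem (mem_nhdsWithin_of_mem_nhds (Metric.ball_mem_nhds s hδ)) self_mem_nhdsWithin
  have hyu' := (hy.frequently (hu.mem_nhds (hyu rfl))).and_eventually hnb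
  have hzv' := (hz.frequently (hv.mem_nhds
    (hRv (show z ∈ R \ {y} from ⟨hRmem z (hclus z hz), hzy⟩)))).and_eventually hnb
  obtain ⟨x1, hx1, hx1'⟩ := hyu'.exists
  obtain ⟨x2, hx2, hx2'⟩ := hzv'.exists
  have hsub : G '' (Metric.ball s δ ∩ H) ⊆ u :=
    hconn.subset_left_of_subset_union hu hv huv (Set.image_subset_iff.2 hball)
      ⟨G x1, Set.mem_image_of_mem G hx1', hx1⟩
  exact Set.disjoint_left.1 huv (hsub (Set.mem_image_of_mem G hx2')) hx2

theorem tendsto_exp_half_line (t : ℝ) :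
    Tendsto (fun x : ℝ => (x : ℂ) + t * Complex.I) (𝓝[>] 0) (𝓝[{s : ℂ | 0 < s.re}] (t * Complex.I)) := by
  rw [tendsto_nhdsWithin_iff]
  constructor
  · have : Continuous fun x : ℝ => (x : ℂ) + t * Complex.I := by fun_prop
    have h := (this.tendsto 0).mono_left (nhdsWithin_le_nhds (s := Set.Ioi 0))
    simpa using h
  · filter_upwards [self_mem_nhdsWithin] with x hx
    simpa using hx

/-- A function of `w` holomorphic outside the unit disc and continuous in the logarithmic
coordinate up to the boundary has the same mean on the unit circle as at infinity. -/
theorem integral_eq_of_tendsto {g : ℂ → ℂ} (hc : ContinuousOn g {s | 0 ≤ s.re})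
    (hd : DifferentiableOn ℂ g {s | 0 < s.re})
    (hper : ∀ s : ℂ, 0 ≤ s.re → g (s + 2 * Real.pi * Complex.I) = g s)
    {h : ℂ → ℂ} (hgh : ∀ s : ℂ, 0 < s.re → g s = h (Complex.exp s)) {l : ℂ}
    (hl : Tendsto h (cocompact ℂ) (𝓝 l)) :
    ∫ t in (0 : ℝ)..(2 * Real.pi), g (t * Complex.I) = 2 * Real.pi * l := by
  have hpi := Real.pi_pos
  -- Cauchy's theorem on the rectangle `[0, x] × [0, 2π]`: the horizontal sides cancel by
  -- periodicity.
  have hconst : ∀ x : ℝ, 0 < x → ∫ t in (0 : ℝ)..(2 * Real.pi), g (t * Complex.I) =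
      ∫ t in (0 : ℝ)..(2 * Real.pi), g (x + t * Complex.I) := by
    intro x hx
    have hR := Complex.integral_boundary_rect_eq_zero_of_continuousOn_of_differentiableOn g
      0 (x + (2 * Real.pi : ℝ) * Complex.I) (hc.mono ?_) (hd.mono ?_)
    · simp only [Complex.zero_re, Complex.zero_im, Complex.add_re, Complex.ofReal_re,
        Complex.mul_re, Complex.I_re, mul_zero, Complex.ofReal_im, Complex.I_im, mul_one, sub_self,
        add_zero, Complex.add_im, Complex.mul_im, zero_add, Complex.ofReal_zero, zero_mul] at hR
      have h1 : ∫ y in (0 : ℝ)..x, g (y + (2 * Real.pi : ℝ) * Complex.I) =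
          ∫ y in (0 : ℝ)..x, g y := by
        refine intervalIntegral.integral_congr fun y hy => ?_
        rw [Set.uIcc_of_le hx.le] at hy
        have := hper y (by simpa using hy.1)
        push_cast
        exact this
      rw [h1, sub_self, zero_add, sub_eq_zero] at hR
      exact ((smul_right_injective ℂ Complex.I_ne_zero) hR).symm
    · intro s hs
      have h1 := hs.1
      simp only [Set.mem_preimage, Complex.zero_re, Complex.add_re, Complex.ofReal_re,
        Complex.mul_re, Complex.I_re, mul_zero, Complex.ofReal_im, Complex.I_im, mul_one, sub_self,
        add_zero, Set.uIcc_of_le hx.le] at h1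
      exact h1.1
    · intro s hs
      have h1 := hs.1
      simp only [Set.mem_preimage, Complex.zero_re, Complex.add_re, Complex.ofReal_re,
        Complex.mul_re, Complex.I_re, mul_zero, Complex.ofReal_im, Complex.I_im, mul_one, sub_self,
        add_zero, min_eq_left hx.le] at h1
      exact h1.1
  rw [← sub_eq_zero, ← norm_le_zero_iff]
  refine le_of_forall_pos_le_add fun ε hε => ?_
  rw [zero_add]
  have hε' : 0 < ε / (2 * Real.pi) := by positivity
  rw [← Metric.cobounded_eq_cocompact] at hl
  obtain ⟨R, -, hR⟩ := hasBasis_cobounded_norm.eventually_iff.1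
    (hl.eventually (Metric.ball_mem_nhds l hε'))
  set x : ℝ := max 1 R with hx
  have hx0 : 0 < x := lt_of_lt_of_le one_pos (le_max_left _ _)
  have hexp : R ≤ Real.exp x := (le_max_right 1 R).trans (by linarith [Real.add_one_le_exp x])
  have hpt : ∀ t : ℝ, g (x + t * Complex.I) = h (Complex.exp (x + t * Complex.I)) :=
    fun t => hgh _ (by simpa using hx0)
  have hbound : ∀ t : ℝ, ‖g (x + t * Complex.I) - l‖ ≤ ε / (2 * Real.pi) := by
    intro t
    have h1 := @hR (Complex.exp (x + t * Complex.I)) (by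
      rw [Set.mem_ofPred_eq, Complex.norm_exp]; simpa using hexp)
    rw [dist_eq_norm] at h1
    rw [hpt]
    exact h1.le
  have hgc : Continuous fun t : ℝ => g (x + t * Complex.I) := by
    refine hc.comp_continuous (by fun_prop) fun t => ?_
    simpa using hx0.le
  have h2 : (∫ t in (0 : ℝ)..(2 * Real.pi), g (t * Complex.I)) - 2 * Real.pi * l =
      ∫ t in (0 : ℝ)..(2 * Real.pi), (g (x + t * Complex.I) - l) := by
    rw [hconst x hx0, intervalIntegral.integral_sub (hgc.intervalIntegrable _ _)
      (continuous_const.intervalIntegrable _ _)]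
    simp
  rw [h2]
  refine (intervalIntegral.norm_integral_le_of_norm_le_const fun t _ => hbound t).trans ?_
  rw [sub_zero, abs_of_pos (by positivity), div_mul_cancel₀ _ (by positivity)]

/-- The boundary parametrisation of a connected lemniscate. -/
theorem IsKPolynomial.exists_boundary_curve {P : ℂ[X]} (hK : IsKPolynomial P) (hP : P.Monic)
    (hdeg : 1 ≤ P.natDegree) :
    ∃ γ : ℝ → ℂ, Continuous γ ∧ (∀ t, γ (t + 2 * Real.pi) = γ t) ∧
      (∀ t : ℝ, P.eval (γ t) = Complex.exp (P.natDegree * (t * Complex.I))) ∧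
      (∀ s t, s < t → t < s + 2 * Real.pi → γ s = γ t →
        γ s ∈ {z | (derivative P).IsRoot z}) ∧
      ∀ m : ℕ, ∫ t in (0 : ℝ)..(2 * Real.pi),
        γ t * Complex.exp (-((m + 1 : ℕ) * t * Complex.I)) = 2 * Real.pi * 0 ^ m := by
  obtain ⟨Ψ, hΨd, hΨi, hPΨ, hΨ1⟩ := hK.exists_exterior_map hP hdeg
  set n := P.natDegree with hn
  set H : Set ℂ := {s | 0 < s.re} with hH
  have hHo : IsOpen H := isOpen_lt continuous_const Complex.continuous_re
  have hHcl : closure H = {s | 0 ≤ s.re} := Complex.closure_setOfPred_lt_re 0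
  have hexp : ∀ s ∈ H, Complex.exp s ∈ {w : ℂ | 1 < ‖w‖} := by
    intro s hs
    rw [Set.mem_ofPred_eq, Complex.norm_exp]
    exact Real.one_lt_exp_iff.2 hs
  -- The coordinate `s = log w` makes the domain a half-plane, whose convexity gives the connected
  -- neighbourhoods needed at the boundary.
  set G₀ : ℂ → ℂ := fun s => Ψ (Complex.exp s) with hG₀
  have hG₀d : DifferentiableOn ℂ G₀ H := hΨd.comp Complex.differentiable_exp.differentiableOn hexp
  have hPG₀ : ∀ s ∈ H, P.eval (G₀ s) = Complex.exp (n * s) := by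
    intro s hs
    rw [hG₀, hPΨ _ (hexp s hs), ← Complex.exp_nat_mul]
  have hlim : ∀ s ∈ closure H, ∃ y, Tendsto G₀ (𝓝[H] s) (𝓝 y) := by
    intro s hs
    refine exists_tendsto_of_tendsto_eval hdeg (convex_halfSpace_re_gt 0) hG₀d.continuousOn hs
      (c := Complex.exp (n * s)) ?_
    have h1 : Continuous fun s : ℂ => Complex.exp (n * s) := by fun_prop
    refine ((h1.tendsto s).mono_left nhdsWithin_le_nhds).congr' ?_
    filter_upwards [self_mem_nhdsWithin] with x hx using (hPG₀ x hx).symm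
  set G := extendFrom H G₀ with hG
  have hGc : ContinuousOn G {s | 0 ≤ s.re} := by
    rw [← hHcl]; exact continuousOn_extendFrom le_rfl hlim
  have hGG₀ : ∀ s ∈ H, G s = G₀ s := extendFrom_extends hG₀d.continuousOn
  have hray : ∀ t : ℝ, Tendsto (fun x : ℝ => G₀ (x + t * Complex.I)) (𝓝[>] 0)
      (𝓝 (G (t * Complex.I))) := by
    intro t
    exact (tendsto_extendFrom (hlim _ (by rw [hHcl]; simp))).comp (tendsto_exp_half_line t)
  have hH_mem : ∀ x t : ℝ, 0 < x → (x : ℂ) + t * Complex.I ∈ H := by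
    intro x t hx
    simpa [hH] using hx
  have hper₀ : ∀ s, G₀ (s + 2 * Real.pi * Complex.I) = G₀ s := by
    intro s
    simp only [hG₀, Complex.exp_add, Complex.exp_two_pi_mul_I, mul_one]
  have hperγ : ∀ t : ℝ, G ((t + 2 * Real.pi : ℝ) * Complex.I) = G (t * Complex.I) := by
    intro t
    refine tendsto_nhds_unique (hray _) ((hray t).congr fun x => ?_)
    rw [← hper₀]
    congr 1
    push_cast; ring
  have hPγ : ∀ t : ℝ, P.eval (G (t * Complex.I)) = Complex.exp (n * (t * Complex.I)) := by
    intro t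
    have h1 := (P.continuous.tendsto _).comp (hray t)
    refine tendsto_nhds_unique h1 ?_
    have h2 : Continuous fun x : ℝ => Complex.exp (n * (x + t * Complex.I)) := by fun_prop
    have h3 := (h2.tendsto 0).mono_left (nhdsWithin_le_nhds (s := Set.Ioi 0))
    rw [Complex.ofReal_zero, zero_add] at h3
    refine h3.congr' ?_
    filter_upwards [self_mem_nhdsWithin] with x hx
    exact (hPG₀ _ (hH_mem x t hx)).symm
  refine ⟨fun t => G (t * Complex.I), ?_, hperγ, hPγ, ?_, ?_⟩
  · exact hGc.comp_continuous (by fun_prop) fun t => by simp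
  · intro s t hst hts hγ
    by_contra hroot
    have hder : (derivative P).eval (G (s * Complex.I)) ≠ 0 := hroot
    have hloc := ((P.hasStrictDerivAt (G (s * Complex.I))).hasStrictFDerivAt_equiv hder)
    have hinv := hloc.eventually_left_inverse
    have e1 := (hray s).eventually hinv
    have e2 := (hray t)
    simp only at hγ
    rw [← hγ] at e2
    obtain ⟨x, ⟨hx1, hx2⟩, hx⟩ := ((e1.and (e2.eventually hinv)).and self_mem_nhdsWithin).exists
    -- If `γ s = γ t` is not critical, `P` is injective near it. Points at equal depth `x` on the
    -- two rays have equal `P`-values since `exp(nis) = exp(nit)`, so they coincide, against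
    -- injectivity of `Ψ`.
    have hEq : P.eval (G₀ (x + s * Complex.I)) = P.eval (G₀ (x + t * Complex.I)) := by
      rw [hPG₀ _ (hH_mem x s hx), hPG₀ _ (hH_mem x t hx), mul_add, mul_add, Complex.exp_add,
        Complex.exp_add, ← hPγ, ← hPγ, hγ]
    rw [hEq, hx2] at hx1
    have h2 := hΨi (hexp _ (hH_mem x t hx)) (hexp _ (hH_mem x s hx)) hx1
    obtain ⟨k, hk⟩ := Complex.exp_eq_exp_iff_exists_int.1 h2
    have h3 := congrArg Complex.im hk
    simp at h3
    have hpi := Real.pi_pos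
    have h4 : (0 : ℝ) < k := by
      by_contra! h
      nlinarith
    have h5 : (k : ℝ) < 1 := by
      by_contra! h
      nlinarith
    have h6 : 0 < k := by exact_mod_cast h4
    have h7 : k < 1 := by exact_mod_cast h5
    omega
  · intro m
    -- In terms of `w` the integrand is `Ψ(w) / w * w⁻¹ ^ m`, whose limit at infinity is `1` for `m
    -- = 0` and `0` otherwise.
    have hI := integral_eq_of_tendsto (g := fun s => G s * Complex.exp (-((m + 1 : ℕ) * s)))
      (h := fun w => Ψ w / w * w⁻¹ ^ m) (l := 0 ^ m) ?_ ?_ ?_ ?_ ?_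
    · rw [← hI]
      refine intervalIntegral.integral_congr fun t _ => ?_
      simp only [mul_assoc]
    · exact hGc.mul (Continuous.continuousOn (by fun_prop))
    · refine DifferentiableOn.mul (hG₀d.congr hGG₀) (Differentiable.differentiableOn ?_)
      fun_prop
    · intro s hs
      have h1 : G (s + 2 * Real.pi * Complex.I) = G s := by
        rcases eq_or_lt_of_le hs with h0 | h0
        · have h2 : s = (s.im : ℂ) * Complex.I := by
            apply Complex.ext <;> simp [← h0]
          have h3 := hperγ s.im
          rw [Complex.ofReal_add, add_mul, ← h2] at h3
          simpa using h3
        · have h2 : s + 2 * Real.pi * Complex.I ∈ H := by simpa [hH] using h0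
          rw [hGG₀ _ h2, hGG₀ s h0, hper₀]
      simp only [h1]
      congr 1
      rw [Complex.exp_eq_exp_iff_exists_int]
      exact ⟨-(m + 1 : ℕ), by push_cast; ring⟩
    · intro s hs
      rw [hGG₀ s hs, Complex.exp_neg, Complex.exp_nat_mul, pow_succ, mul_inv, inv_pow,
        div_eq_mul_inv, hG₀]
      ring
    · have h1 := hΨ1.mul (tendsto_inv_cocompact.pow m)
      rwa [one_mul] at h1

/-! ### Fourier rigidity and the circle -/

/-- A continuous periodic function whose only nonzero Fourier modes are `0` and `1`. -/
theorem eq_add_exp_of_integral_eq_zero {γ : ℝ → ℂ} (hγ : Continuous γ)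
    (hper : ∀ t, γ (t + 2 * Real.pi) = γ t)
    (h1 : ∫ t in (0 : ℝ)..(2 * Real.pi), γ t * Complex.exp (-((1 : ℤ) * t * Complex.I)) =
      2 * Real.pi)
    (h : ∀ j : ℤ, j ≠ 0 → j ≠ 1 →
      ∫ t in (0 : ℝ)..(2 * Real.pi), γ t * Complex.exp (-(j * t * Complex.I)) = 0) :
    ∃ b : ℂ, ∀ t : ℝ, γ t = b + Complex.exp (t * Complex.I) := by
  have : Fact (0 < 2 * Real.pi) := ⟨Real.two_pi_pos⟩
  have hpi : (Real.pi : ℂ) ≠ 0 := by exact_mod_cast Real.pi_ne_zero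
  have hP : Function.Periodic γ (2 * Real.pi) := hper
  set f : C(AddCircle (2 * Real.pi), ℂ) := ⟨hP.lift, by
    exact continuous_coinduced_dom.2 hγ⟩ with hf
  have hfγ : ∀ t : ℝ, f t = γ t := fun t => hP.lift_coe t
  have hfour : ∀ (j : ℤ) (t : ℝ), fourier j (t : AddCircle (2 * Real.pi)) =
      Complex.exp (j * t * Complex.I) := by
    intro j t
    rw [fourier_coe_apply]
    congr 1
    push_cast
    field_simp
  have hcoef : ∀ j : ℤ, fourierCoeff f j = (1 / (2 * Real.pi) : ℝ) •
      ∫ t in (0 : ℝ)..(2 * Real.pi), γ t * Complex.exp (-(j * t * Complex.I)) := by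
    intro j
    rw [fourierCoeff_eq_intervalIntegral _ _ 0, zero_add]
    congr 1
    refine intervalIntegral.integral_congr fun t _ => ?_
    simp only [hfγ]
    rw [hfour, smul_eq_mul, mul_comm]
    congr 2
    push_cast; ring
  have hzero : ∀ j ∉ ({0, 1} : Finset ℤ), fourierCoeff f j = 0 := by
    intro j hj
    simp only [Finset.mem_insert, Finset.mem_singleton, not_or] at hj
    rw [hcoef, h j hj.1 hj.2, smul_zero]
  have hone : fourierCoeff f 1 = 1 := by
    rw [hcoef, h1, Complex.real_smul]
    push_cast
    field_simp
  refine ⟨fourierCoeff f 0, fun t => ?_⟩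
  have hsum : Summable (fourierCoeff f) :=
    summable_of_ne_finset_zero hzero
  have hs := has_pointwise_sum_fourier_series_of_summable
    hsum (t : AddCircle (2 * Real.pi))
  have hs2 := hasSum_sum_of_ne_finset_zero
    (L := SummationFilter.unconditional ℤ) (f := fun i => fourierCoeff f i • fourier i
    (t : AddCircle (2 * Real.pi))) (s := {0, 1}) fun j hj => by rw [hzero j hj, zero_smul]
  have h3 := hs.unique hs2
  rw [hfγ] at h3
  rw [h3, Finset.sum_pair zero_ne_one, hone, hfour, hfour]
  simp

theorem exists_norm_eq_one_mul_eq_norm (w : ℂ) : ∃ ζ : ℂ, ‖ζ‖ = 1 ∧ ζ * w = ‖w‖ := by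
  rcases eq_or_ne w 0 with rfl | hw
  · exact ⟨1, by simp⟩
  · have h0 : ‖w‖ ≠ 0 := norm_ne_zero_iff.2 hw
    have h1 : (‖w‖ : ℂ) ≠ 0 := by exact_mod_cast h0
    refine ⟨‖w‖ / w, by simp [h0], by field_simp⟩

/-- The frequencies `-k` and `k + 2` are symmetric about `1`, so the sum is `exp(-it) * (1 + 2 i ε
Re u)` with `|u| = 1`. Its squared modulus is at most `1 + 4 ε ^ 2 ≤ (1 + 2 ε ^ 2) ^ 2`. -/
theorem norm_perturbed_exp_le (ζ : ℂ) (hζ : ‖ζ‖ = 1) (k : ℕ) (ε t : ℝ) :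
    ‖Complex.exp (-((1 : ℤ) * t * Complex.I)) +
      (Complex.I * ε * ζ * Complex.exp (-((-k : ℤ) * t * Complex.I)) +
      Complex.I * ε * (starRingEnd ℂ) ζ * Complex.exp (-((k + 2 : ℤ) * t * Complex.I)))‖ ≤
      1 + 2 * ε ^ 2 := by
  set u : ℂ := ζ * Complex.exp ((k + 1) * t * Complex.I) with hu
  have hun : ‖u‖ = 1 := by
    have : ((k : ℂ) + 1) * t * Complex.I = ((k + 1 : ℝ) * t : ℝ) * Complex.I := by push_cast; ring
    rw [hu, norm_mul, hζ, one_mul, this, Complex.norm_exp_ofReal_mul_I]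
  have hconj : (starRingEnd ℂ) u = (starRingEnd ℂ) ζ * Complex.exp (-((k + 1) * t * Complex.I)) := by
    rw [hu, map_mul, ← Complex.exp_conj]
    simp
  have h1 : Complex.exp (-((1 : ℤ) * t * Complex.I)) +
      (Complex.I * ε * ζ * Complex.exp (-((-k : ℤ) * t * Complex.I)) +
      Complex.I * ε * (starRingEnd ℂ) ζ * Complex.exp (-((k + 2 : ℤ) * t * Complex.I))) =
      Complex.exp ((-t : ℝ) * Complex.I) * (1 + (2 * ε * u.re : ℝ) * Complex.I) := by
    have h2 : Complex.exp (-((-k : ℤ) * t * Complex.I)) =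
        Complex.exp ((-t : ℝ) * Complex.I) * Complex.exp ((k + 1) * t * Complex.I) := by
      rw [← Complex.exp_add]; congr 1; push_cast; ring
    have h3 : Complex.exp (-((k + 2 : ℤ) * t * Complex.I)) =
        Complex.exp ((-t : ℝ) * Complex.I) * Complex.exp (-((k + 1) * t * Complex.I)) := by
      rw [← Complex.exp_add]; congr 1; push_cast; ring
    have h4 : Complex.exp (-((1 : ℤ) * t * Complex.I)) = Complex.exp ((-t : ℝ) * Complex.I) := by
      congr 1; push_cast; ring
    have h5 : ((2 * ε * u.re : ℝ) : ℂ) = ε * (u + (starRingEnd ℂ) u) := by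
      rw [Complex.add_conj]; push_cast; ring
    rw [h2, h3, h4, h5, hconj, hu]
    ring
  rw [h1, norm_mul, Complex.norm_exp_ofReal_mul_I, one_mul]
  have h6 : u.re ^ 2 ≤ 1 := by
    have := Complex.abs_re_le_norm u
    rw [hun] at this
    exact (sq_le_one_iff_abs_le_one _).2 this
  refine le_of_sq_le_sq ?_ (by positivity)
  rw [Complex.sq_norm, Complex.normSq_apply]
  simp
  nlinarith [sq_nonneg ε, sq_nonneg (ε ^ 2), mul_nonneg (sq_nonneg ε) (sub_nonneg.2 h6)]

theorem hausdorffMeasure_sphere_le (a : ℂ) :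
    Measure.hausdorffMeasure 1 (Metric.sphere a 1) ≤ ENNReal.ofReal (2 * Real.pi) := by
  have hlip : LipschitzWith 1 (circleMap a 1) := by
    simpa using lipschitzWith_circleMap a 1
  have h1 := (hlip.lipschitzOnWith (s := Set.Ioc 0 (2 * Real.pi))).hausdorffMeasure_image_le
    (d := 1) zero_le_one
  rw [image_circleMap_Ioc, hausdorffMeasure_real, Real.volume_Ioc] at h1
  simpa using h1

theorem lemniscate_pow_eq_sphere {n : ℕ} (hn : n ≠ 0) (a : ℂ) :
    lemniscate ((X - C a) ^ n) 0 = Metric.sphere a 1 := by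
  ext z
  rw [mem_lemniscate_zero_iff, mem_sphere_iff_norm]
  simp [pow_eq_one_iff_of_nonneg (norm_nonneg _) hn]

theorem eq_pow_of_eval_circle {P : ℂ[X]} {b : ℂ}
    (h : ∀ t : ℝ, P.eval (b + Complex.exp (t * Complex.I)) =
      Complex.exp (P.natDegree * (t * Complex.I))) : P = (X - C b) ^ P.natDegree := by
  refine Polynomial.eq_of_infinite_eval_eq _ _ ?_
  have hcont : Continuous fun t : ℝ => b + Complex.exp (t * Complex.I) := by fun_prop
  have hinf : (Set.range fun t : ℝ => b + Complex.exp (t * Complex.I)).Infinite := by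
    refine (isPreconnected_range hcont).infinite_of_nontrivial ⟨_, ⟨0, rfl⟩, _, ⟨Real.pi, rfl⟩, ?_⟩
    simp only [Complex.ofReal_zero, zero_mul, Complex.exp_zero, Complex.exp_pi_mul_I]
    intro h
    have := add_left_cancel h
    norm_num at this
  refine hinf.mono ?_
  rintro _ ⟨t, rfl⟩
  change P.eval _ = _
  rw [h, Complex.exp_nat_mul]
  simp

/-! ### The lower bound and its equality case -/

theorem mainTheorem7 (P : Polynomial ℂ) (hP : P.Monic) (hdeg : 1 ≤ P.natDegree)
    (hK : IsKPolynomial P) :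
    ENNReal.ofReal (2 * Real.pi) ≤ planeLength (lemniscate P 0) ∧
      (planeLength (lemniscate P 0) = ENNReal.ofReal (2 * Real.pi) ↔
        ∃ a : ℂ, P = (Polynomial.X - Polynomial.C a) ^ P.natDegree) := by
  have hpi := Real.pi_pos
  obtain ⟨γ, hγ, hper, hPγ, hinj, hint⟩ := hK.exists_boundary_curve hP hdeg
  have hder : derivative P ≠ 0 := by
    intro h
    have := derivative_eq_zero.1 h
    omega
  have hC : {z | (derivative P).IsRoot z}.Countable := (finite_setOfPred_isRoot hder).countable
  have hE : ∀ t, γ t ∈ lemniscate P 0 := by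
    intro t
    rw [mem_lemniscate_zero_iff, hPγ, Complex.norm_exp]
    simp
  have hone : ∫ t in (0 : ℝ)..(2 * Real.pi), γ t * Complex.exp (-((1 : ℤ) * t * Complex.I)) =
      2 * Real.pi := by
    simpa using hint 0
  have hpos : ∀ m : ℕ, ∫ t in (0 : ℝ)..(2 * Real.pi),
      γ t * Complex.exp (-((m + 2 : ℤ) * t * Complex.I)) = 0 := by
    intro m
    have h1 := hint (m + 1)
    rw [zero_pow (Nat.succ_ne_zero m), mul_zero] at h1
    rw [← h1]
    refine intervalIntegral.integral_congr fun t _ => ?_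
    congr 4
  have hmain : ENNReal.ofReal (2 * Real.pi) ≤ planeLength (lemniscate P 0) := by
    by_cases hfin : Measure.hausdorffMeasure 1 (lemniscate P 0) = ⊤
    · exact le_of_le_of_eq le_top hfin.symm
    · have h1 := norm_sum_fourier_le hγ hper hC hE hinj hfin {1} (fun _ => 1) (M := 1) (by
        intro t
        rw [Finset.sum_singleton, one_mul, Complex.norm_exp]
        simp)
      rw [Finset.sum_singleton, hone] at h1
      refine ENNReal.ofReal_le_of_le_toReal ?_
      simpa [planeLength, abs_of_pos hpi] using h1
  refine ⟨hmain, fun hL => ?_, ?_⟩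
  · have hfin : Measure.hausdorffMeasure 1 (lemniscate P 0) ≠ ⊤ :=
      ne_of_eq_of_ne hL ENNReal.ofReal_ne_top
    have hLr : (Measure.hausdorffMeasure 1 (lemniscate P 0)).toReal = 2 * Real.pi := by
      have := congrArg ENNReal.toReal hL
      rwa [ENNReal.toReal_ofReal (by positivity)] at this
    have hneg : ∀ k : ℕ, 0 < k → ∫ t in (0 : ℝ)..(2 * Real.pi),
        γ t * Complex.exp (-((-k : ℤ) * t * Complex.I)) = 0 := by
      intro k hk
      set c := ∫ t in (0 : ℝ)..(2 * Real.pi), γ t * Complex.exp (-((-k : ℤ) * t * Complex.I))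
        with hc
      -- This phase gives `ζ * c = I * ‖c‖`, so the perturbation adds to the main term `2π * I`
      -- without cancellation.
      obtain ⟨ζ, hζ, hζc⟩ := exists_norm_eq_one_mul_eq_norm (-Complex.I * c)
      have hnorm : ‖-Complex.I * c‖ = ‖c‖ := by simp
      rw [hnorm] at hζc
      -- The pairing gives `2π + ε k ‖c‖ ≤ (1 + 2 ε ^ 2) * 2π`. The frequency `k + 2`, needed to
      -- keep the sup norm small, contributes nothing by `hpos`.
      have hle : ∀ ε : ℝ, 0 < ε → k * ‖c‖ ≤ 4 * Real.pi * ε := by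
        intro ε hε
        have hk1 : (1 : ℤ) ∉ ({(-k : ℤ), (k + 2 : ℤ)} : Finset ℤ) := by
          simp only [Finset.mem_insert, Finset.mem_singleton]; omega
        have hk2 : (-k : ℤ) ∉ ({(k + 2 : ℤ)} : Finset ℤ) := by
          simp only [Finset.mem_singleton]; omega
        set α : ℤ → ℂ := fun j => if j = 1 then 1 else if j = -k then Complex.I * ε * ζ
          else Complex.I * ε * (starRingEnd ℂ) ζ with hα
        have hα1 : α 1 = 1 := if_pos rfl
        have hα2 : α (-k : ℤ) = Complex.I * ε * ζ := by
          exact (if_neg (by omega)).trans (if_pos rfl)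
        have hα3 : α (k + 2 : ℤ) = Complex.I * ε * (starRingEnd ℂ) ζ := by
          exact (if_neg (by omega)).trans (if_neg (by omega))
        have h1 := norm_sum_fourier_le hγ hper hC hE hinj hfin {1, (-k : ℤ), (k + 2 : ℤ)} α
          (M := 1 + 2 * ε ^ 2) (by
            intro t
            rw [Finset.sum_insert hk1, Finset.sum_insert hk2, Finset.sum_singleton, hα1, hα2, hα3,
              one_mul]
            exact norm_perturbed_exp_le ζ hζ k ε t)
        have h2 := hpos k
        rw [Finset.sum_insert hk1, Finset.sum_insert hk2, Finset.sum_singleton, hα1, hα2, hα3,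
          hone, h2, ← hc, hLr] at h1
        have h3 : 1 * (((1 : ℤ) : ℂ) * Complex.I) * (2 * Real.pi) +
            (Complex.I * ε * ζ * (((-k : ℤ) : ℂ) * Complex.I) * c +
              Complex.I * ε * (starRingEnd ℂ) ζ * (((k + 2 : ℤ) : ℂ) * Complex.I) * 0) =
            Complex.I * ((2 * Real.pi + ε * (k * ‖c‖) : ℝ) : ℂ) := by
          push_cast
          rw [← hζc]
          ring
        rw [h3, norm_mul, Complex.norm_I, one_mul, Complex.norm_real,
          Real.norm_of_nonneg (by positivity)] at h1
        have h4 : ε * (k * ‖c‖) ≤ ε * (4 * Real.pi * ε) := by linarith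
        exact le_of_mul_le_mul_left h4 hε
      have h0 : (k : ℝ) * ‖c‖ ≤ 0 := by
        refine le_of_forall_pos_le_add fun δ hδ => ?_
        have h5 := hle (δ / (4 * Real.pi)) (by positivity)
        rw [mul_div_cancel₀ _ (by positivity)] at h5
        linarith
      have hk' : (0 : ℝ) < k := by exact_mod_cast hk
      exact norm_le_zero_iff.1 (nonpos_of_mul_nonpos_right h0 hk')
    obtain ⟨b, hb⟩ := eq_add_exp_of_integral_eq_zero hγ hper hone (by
      intro j hj0 hj1
      rcases lt_or_gt_of_ne hj0 with h | h
      · obtain ⟨k, hk⟩ := Int.eq_ofNat_of_zero_le (show 0 ≤ -j by omega)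
        obtain rfl : j = -(k : ℤ) := by omega
        exact hneg k (by omega)
      · obtain ⟨m, hm⟩ := Int.eq_ofNat_of_zero_le (show 0 ≤ j - 2 by omega)
        obtain rfl : j = (m : ℤ) + 2 := by omega
        exact hpos m)
    exact ⟨b, eq_pow_of_eval_circle fun t => by rw [← hb, hPγ]⟩
  · rintro ⟨a, ha⟩
    refine le_antisymm ?_ hmain
    rw [ha, lemniscate_pow_eq_sphere (by omega)]
    exact hausdorffMeasure_sphere_le a
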